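/- Let $L$ be a first-order language, let $\mathcal U$ be an $L$-structure (for example, a monster model of an $L$-theory $T$), and let $\varphi(x;y)$ be a partitioned $L$-formula without parameters, where $x$ and $y$ are finite tuples of variables. Write $\mathcal U^x$ and $\mathcal U^y$ for the sets of tuples of elements of $\mathcal U$ of the corresponding lengths. Say that $\varphi(x;y)$ is IP (in $\mathcal U$) if for every $k\in\mathbb N$ there is $A\subseteq \mathcal U^x$ with $|A|\ge k$ such that for every $K\subseteq A$ there is $b_K\in\mathcal U^y$ with $\{c\in A:\mathcal U\models\varphi(c,b_K)\}=K$, and that $\varphi(x;y)$ is NIP if it is not IP. For a set $X$, let $\operatorname{conv}(X)$ be the set of all measures on $\mathcal P(X)$ of the form $\sum_{i=1}^n r_i\delta_{x_i}$ with $n\in\mathbb N$, $x_i\in X$, $r_i>0$ and $\sum_{i=1}^n r_i=1$, where $\delta_{x}$ is the Dirac measure at $x$. For $f:X\times Y\to\{0,1\}$, define $\Psi_f:\operatorname{conv}(X)\times\operatorname{conv}(Y)\to[0,1]$ by $\Psi_f(\mu,\nu)=\int_Y\int_X f(x,y)\,d\mu(x)\,d\nu(y)$. For sets $X,Y$, a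 function $F:X\times Y\to[0,1]$, $r\in(0,1)$ and $\epsilon>0$, say that $F$ $(r,\epsilon)$-shatters $A\subseteq X$ if for every $K\subseteq A$ there is $b_K\in Y$ with $$\{a\in A: F(a,b_K)\le r\}=K\quad\text{and}\quad \{a\in A: F(a,b_K)\ge r+\epsilon\}=A\setminus K .$$ The function $F$ is called dependent if there are no $r\in(0,1)$ and $\epsilon>0$ such that for every $n\in\mathbb N$ there is $A\subseteq X$ with $|A|>n$ that is $(r,\epsilon)$-shattered by $F$. **Theorem.** Suppose that $\varphi(x;y)$ is NIP, and let $f:\mathcal U^x\times\mathcal U^y\to\{0,1\}$ be given by $f(a,b)=1$ if $\mathcal U\models\varphi(a,b)$ and $f(a,b)=0$ otherwise. Then the map $\Psi_f:\operatorname{conv}(\mathcal U^x)\times\operatorname{conv}(\mathcal U^y)\to[0,1]$ is dependent. -/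

import Mathlib

open MeasureTheory
open scoped NNReal

namespace ContVC

/-- The truth set `φ(a, b)` in the structure `U`, for a formula `φ(x; y)` whose variables are
partitioned into the object variables `x` (indexed by `Fin m`) and the parameter variables `y`
(indexed by `Fin n`). -/
def Holds {L : FirstOrder.Language} {U : Type*} [L.Structure U] {m n : ℕ}
    (φ : L.Formula (Fin m ⊕ Fin n)) (a : Fin m → U) (b : Fin n → U) : Prop :=
  φ.Realize (Sum.elim a b)

/-- `φ(x; y)` is IP in `U`: for every `k` there is a set `A` of at least `k` many `x`-tuples all
of whose subsets are cut out by instances `φ(x; b)`. -/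
def IsIP {L : FirstOrder.Language} (U : Type*) [L.Structure U] {m n : ℕ}
    (φ : L.Formula (Fin m ⊕ Fin n)) : Prop :=
  ∀ k : ℕ, ∃ A : Set (Fin m → U), (k : ℕ∞) ≤ A.encard ∧
    ∀ K ⊆ A, ∃ b : Fin n → U, {c | c ∈ A ∧ Holds φ c b} = K

/-- `φ(x; y)` is NIP in `U`. -/
def IsNIP {L : FirstOrder.Language} (U : Type*) [L.Structure U] {m n : ℕ}
    (φ : L.Formula (Fin m ⊕ Fin n)) : Prop :=
  ¬ IsIP U φ

open Classical in
/-- The function `f : U^x × U^y → {0, 1}` with `f(a, b) = 1` iff `U ⊨ φ(a, b)`. -/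
noncomputable def formulaIndicator {L : FirstOrder.Language} (U : Type*) [L.Structure U] {m n : ℕ}
    (φ : L.Formula (Fin m ⊕ Fin n)) (a : Fin m → U) (b : Fin n → U) : ({0, 1} : Set ℝ) :=
  ⟨if Holds φ a b then 1 else 0, by split_ifs <;> simp⟩

/-- `f` `(r, ε)`-shatters `A`. -/
def Shatters {X Y : Type*} (f : X → Y → unitInterval) (r ε : ℝ) (A : Set X) : Prop :=
  ∀ K ⊆ A, ∃ b : Y,
    {a : X | (f a b : ℝ) ≤ r} ∩ A = K ∧ {a : X | r + ε ≤ (f a b : ℝ)} ∩ A = A \ K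

/-- `f` is `(r, ε)`-independent: it `(r, ε)`-shatters sets with arbitrarily many elements. -/
def IndependentAt {X Y : Type*} (f : X → Y → unitInterval) (r ε : ℝ) : Prop :=
  ∀ n : ℕ, ∃ A : Set X, (n : ℕ∞) < A.encard ∧ Shatters f r ε A

/-- `f` is independent. -/
def Independent {X Y : Type*} (f : X → Y → unitInterval) : Prop :=
  ∃ r ∈ Set.Ioo (0 : ℝ) 1, ∃ ε > (0 : ℝ), IndependentAt f r ε

/-- `f` is dependent. -/
def Dependent {X Y : Type*} (f : X → Y → unitInterval) : Prop :=
  ¬ Independent f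

/-- `conv(X)`: the convex combinations `∑ i, r i • δ_{x i}`, with positive weights of sum `1`, of
Dirac measures on the full power set of `X`. -/
def Conv (X : Type*) : Set (@Measure X ⊤) :=
  {μ | ∃ (n : ℕ) (x : Fin n → X) (r : Fin n → ℝ≥0),
    (∀ i, 0 < r i) ∧ ∑ i, r i = 1 ∧ μ = ∑ i, r i • @Measure.dirac X ⊤ (x i)}

theorem integral_conv {X : Type*} {n : ℕ} (x : Fin n → X) (r : Fin n → ℝ≥0) (g : X → ℝ) :
    ∫ a, g a ∂(∑ i, r i • @Measure.dirac X ⊤ (x i)) = ∑ i, (r i : ℝ) * g (x i) := by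
  let _ : MeasurableSpace X := ⊤
  have : MeasurableSingletonClass X := ⟨fun _ => trivial⟩
  rw [integral_finsetSum_measure]
  · simp [integral_smul_nnreal_measure, NNReal.smul_def]
  · intro i _
    exact (integrable_dirac (by finiteness)).smul_measure_nnreal

theorem integral_conv_mem {X : Type*} (μ : Conv X) (g : X → ℝ)
    (hg : ∀ a, g a ∈ Set.Icc (0 : ℝ) 1) : ∫ a, g a ∂μ.1 ∈ Set.Icc (0 : ℝ) 1 := by
  obtain ⟨μ, n, x, r, -, hr, rfl⟩ := μ
  rw [integral_conv]
  have hr' : ∑ i, (r i : ℝ) = 1 := by exact_mod_cast hr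
  refine ⟨Finset.sum_nonneg fun i _ => mul_nonneg (r i).2 (hg _).1, ?_⟩
  rw [← hr']
  exact Finset.sum_le_sum fun i _ => mul_le_of_le_one_right (r i).2 (hg _).2

/-- `Ψ_f(μ, ν) = ∫∫ f(x, y) dμ(x) dν(y)`, as a map `conv(X) × conv(Y) → [0, 1]`. -/
noncomputable def Psi {X Y : Type*} (f : X → Y → ({0, 1} : Set ℝ)) (μ : Conv X) (ν : Conv Y) :
    unitInterval :=
  ⟨∫ y, ∫ x, (f x y : ℝ) ∂μ.1 ∂ν.1, integral_conv_mem ν _ fun y => integral_conv_mem μ _ fun x => by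
    rcases (f x y).2 with h | h
    · simp [h]
    · simp [Set.mem_singleton_iff.1 h]⟩

/-- The integral is the expected double sum. -/
theorem Psi_eq_sum {X Y : Type*} (f : X → Y → ({0, 1} : Set ℝ)) (μ : Conv X) (ν : Conv Y)
    {n k : ℕ} (a : Fin n → X) (r : Fin n → ℝ≥0) (b : Fin k → Y) (s : Fin k → ℝ≥0)
    (hμ : μ.1 = ∑ i, r i • @Measure.dirac X ⊤ (a i))
    (hν : ν.1 = ∑ j, s j • @Measure.dirac Y ⊤ (b j)) :
    (Psi f μ ν : ℝ) = ∑ i, ∑ j, (r i : ℝ) * s j * f (a i) (b j) := by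
  simp only [Psi, hμ, hν, integral_conv]
  rw [Finset.sum_comm]
  refine Finset.sum_congr rfl fun j _ => ?_
  rw [Finset.mul_sum]
  exact Finset.sum_congr rfl fun i _ => by ring

end ContVC

/-! Suppose `n = 2 ^ m` measures `μ_i` are shattered with gap `ε` by measures `ν_K`, `K ⊆ Fin n`.
Each `μ_i` is replaced by an average of `N = O(n)` points, accurate against all `2 ^ n` measures
`ν_K`; then each `ν_K` by an average of `N' = O(log n)` points, accurate against the `n` averages
just found (`exists_average_approx`). The errors stay below `ε / 2`, so `K` can be read off from the
traces of the `N'` points of `ν_K` on the at most `n * N` points of the `μ_i`. By Sauer–Shelah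
(`card_traces_le`) there are at most `(n * N + 1) ^ k` traces, hence `2 ^ n ≤ (n * N + 1) ^ (k * N')
= 2 ^ O((log n) ^ 2)`, which is false for large `m`. The linear size of `N` is harmless, since only
its logarithm counts; `N'` sits in the exponent and has to be logarithmic. -/

namespace ContVC

/-! ### Approximating convex combinations by short averages -/

/-- Multiplicative weights: from a convex combination in which all test functions `h j` have mean
zero one can pick points one at a time so that the exponential potential grows slowly. -/
theorem exists_sum_exp_le {X J : Type*} [Fintype J] {k : ℕ} (x : Fin k → X) (r : Fin k → ℝ)
    (hr : ∀ i, 0 ≤ r i) (hr1 : ∑ i, r i = 1) (h : J → X → ℝ) (hh : ∀ j a, |h j a| ≤ 1)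
    (h0 : ∀ j, ∑ i, r i * h j (x i) = 0) {l : ℝ} (hl0 : 0 ≤ l) (hl1 : l ≤ 1) (N : ℕ) :
    ∃ a : Fin N → X, ∑ j, Real.exp (l * ∑ t, h j (a t)) ≤
      Fintype.card J * Real.exp (N * l ^ 2) := by
  induction N with
  | zero => exact ⟨Fin.elim0, by simp⟩
  | succ N ih =>
    obtain ⟨a, ha⟩ := ih
    -- Since `exp u ≤ 1 + u + u ^ 2` for `|u| ≤ 1`, mean zero removes the linear term.
    have key : ∀ j, ∑ i, r i * Real.exp (l * h j (x i)) ≤ Real.exp (l ^ 2) := by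
      intro j
      have h1 : ∀ i, Real.exp (l * h j (x i)) ≤ 1 + l * h j (x i) + l ^ 2 := by
        intro i
        have h2 : |l * h j (x i)| ≤ l := by
          rw [abs_mul, abs_of_nonneg hl0]
          exact mul_le_of_le_one_right hl0 (hh _ _)
        have h3 := (abs_le.1 (Real.abs_exp_sub_one_sub_id_le (h2.trans hl1))).2
        have h4 : (l * h j (x i)) ^ 2 ≤ l ^ 2 := sq_le_sq' (abs_le.1 h2).1 (abs_le.1 h2).2
        linarith
      calc ∑ i, r i * Real.exp (l * h j (x i))
          ≤ ∑ i, r i * (1 + l * h j (x i) + l ^ 2) :=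
            Finset.sum_le_sum fun i _ => mul_le_mul_of_nonneg_left (h1 i) (hr i)
        _ = (∑ i, r i) * (1 + l ^ 2) + l * ∑ i, r i * h j (x i) := by
            rw [Finset.sum_mul, Finset.mul_sum, ← Finset.sum_add_distrib]
            exact Finset.sum_congr rfl fun i _ => by ring
        _ ≤ Real.exp (l ^ 2) := by
            rw [hr1, h0]
            linarith [Real.add_one_le_exp (l ^ 2)]
    set B : ℝ := Fintype.card J * Real.exp ((N + 1 : ℕ) * l ^ 2) with hB
    have avg : ∑ i, r i * ∑ j, Real.exp (l * (h j (x i) + ∑ t, h j (a t))) ≤ ∑ i, r i * B := by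
      calc ∑ i, r i * ∑ j, Real.exp (l * (h j (x i) + ∑ t, h j (a t)))
          = ∑ j, Real.exp (l * ∑ t, h j (a t)) * ∑ i, r i * Real.exp (l * h j (x i)) := by
            simp only [Finset.mul_sum]
            rw [Finset.sum_comm]
            refine Finset.sum_congr rfl fun j _ => Finset.sum_congr rfl fun i _ => ?_
            rw [← Finset.mul_sum, mul_add, Real.exp_add]
            ring
        _ ≤ ∑ j, Real.exp (l * ∑ t, h j (a t)) * Real.exp (l ^ 2) :=
            Finset.sum_le_sum fun j _ => mul_le_mul_of_nonneg_left (key j) (Real.exp_pos _).le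
        _ ≤ (Fintype.card J * Real.exp (N * l ^ 2)) * Real.exp (l ^ 2) := by
            rw [← Finset.sum_mul]
            exact mul_le_mul_of_nonneg_right ha (Real.exp_pos _).le
        _ = ∑ i, r i * B := by
            rw [← Finset.sum_mul, hr1, hB, mul_assoc, ← Real.exp_add]
            push_cast
            ring_nf
    have hne : (Finset.univ : Finset (Fin k)).Nonempty := by
      by_contra hne
      rw [Finset.not_nonempty_iff_eq_empty] at hne
      simp [hne] at hr1
    -- If every extension of `a` by some `x i` exceeded `B`, so would their weighted average.
    by_contra! hcon
    have hgt : ∀ i, B < ∑ j, Real.exp (l * (h j (x i) + ∑ t, h j (a t))) := by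
      intro i
      simpa [Fin.sum_univ_succ] using hcon (Fin.cons (x i) a)
    have hpos : ∃ i, 0 < r i := by
      by_contra! hneg
      have : ∑ i, r i ≤ 0 := Finset.sum_nonpos fun i _ => hneg i
      linarith
    obtain ⟨i, hi⟩ := hpos
    exact absurd avg (not_le.2 (Finset.sum_lt_sum
      (fun i _ => mul_le_mul_of_nonneg_left (hgt i).le (hr i))
      ⟨i, Finset.mem_univ i, mul_lt_mul_of_pos_left (hgt i) hi⟩))

/-- A convex combination is approximated, simultaneously on finitely many test functions with
values in `[0, 1]`, by an average whose length is logarithmic in the number of functions. -/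
theorem exists_average_approx {X J : Type*} [Fintype J] {k : ℕ} (x : Fin k → X) (r : Fin k → ℝ)
    (hr : ∀ i, 0 ≤ r i) (hr1 : ∑ i, r i = 1) (g : J → X → ℝ)
    (hg : ∀ j a, g j a ∈ Set.Icc (0 : ℝ) 1) {δ : ℝ} (hδ0 : 0 < δ) (hδ1 : δ ≤ 1) {N : ℕ}
    (hN0 : 0 < N) (hN : 4 * Real.log (2 * Fintype.card J) ≤ N * δ ^ 2) :
    ∃ a : Fin N → X, ∀ j, |∑ i, r i * g j (x i) - (N : ℝ)⁻¹ * ∑ t, g j (a t)| ≤ δ := by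
  set M : J → ℝ := fun j => ∑ i, r i * g j (x i) with hM
  have hM01 : ∀ j, M j ∈ Set.Icc (0 : ℝ) 1 := fun j =>
    ⟨Finset.sum_nonneg fun i _ => mul_nonneg (hr i) (hg _ _).1, by
      rw [← hr1]
      exact Finset.sum_le_sum fun i _ => mul_le_of_le_one_right (hr i) (hg _ _).2⟩
  have hmean : ∀ j, ∑ i, r i * (g j (x i) - M j) = 0 := fun j => by
    simp only [mul_sub, Finset.sum_sub_distrib, ← Finset.sum_mul, hr1, one_mul]
    exact sub_self _
  have habs : ∀ j a, |g j a - M j| ≤ 1 := fun j a => by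
    rw [abs_le]
    constructor <;> linarith [(hg j a).1, (hg j a).2, (hM01 j).1, (hM01 j).2]
  -- Each centred function is taken with both signs to get a two-sided bound; hence the `2` inside
  -- the logarithm.
  obtain ⟨a, ha⟩ := exists_sum_exp_le (J := J ⊕ J) x r hr hr1
    (Sum.elim (fun j b => g j b - M j) (fun j b => -(g j b - M j)))
    (by rintro (j | j) b
        · exact habs j b
        · simpa only [Sum.elim_inr, abs_neg] using habs j b)
    (by rintro (j | j)
        · exact hmean j
        · simpa only [Sum.elim_inr, mul_neg, Finset.sum_neg_distrib, neg_eq_zero] using hmean j)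
    (l := δ / 2) (by linarith) (by linarith) N
  refine ⟨a, fun j => ?_⟩
  have hJ : (0 : ℝ) < 2 * Fintype.card J := by
    have : 0 < Fintype.card J := Fintype.card_pos_iff.2 ⟨j⟩
    positivity
  have hNR : (0 : ℝ) < N := by exact_mod_cast hN0
  have bound : ∀ s : J ⊕ J, ∑ t, Sum.elim (fun j b => g j b - M j)
      (fun j b => -(g j b - M j)) s (a t) ≤ N * δ := by
    intro s
    have h1 := (Finset.single_le_sum (fun s _ => (Real.exp_pos _).le) (Finset.mem_univ s)).trans ha
    have h2 : (Fintype.card (J ⊕ J) : ℝ) = Real.exp (Real.log (2 * Fintype.card J)) := by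
      rw [Real.exp_log hJ, Fintype.card_sum]
      push_cast
      ring
    rw [h2, ← Real.exp_add, Real.exp_le_exp] at h1
    -- With `l = δ / 2`, both `log (2 * card J)` and `N * l ^ 2` are at most `N * δ ^ 2 / 4`;
    -- together they give `l * (N * δ)`.
    refine le_of_mul_le_mul_left (h1.trans ?_) (half_pos hδ0)
    nlinarith
  have e1 := bound (Sum.inl j)
  have e2 := bound (Sum.inr j)
  simp only [Sum.elim_inl, Sum.elim_inr, Finset.sum_neg_distrib, Finset.sum_sub_distrib,
    Finset.sum_const, Finset.card_univ, Fintype.card_fin, nsmul_eq_mul] at e1 e2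
  have e3 : M j - (N : ℝ)⁻¹ * ∑ t, g j (a t) = (N : ℝ)⁻¹ * (N * M j - ∑ t, g j (a t)) := by
    field_simp
  rw [e3, abs_mul, abs_of_pos (inv_pos.2 hNR), inv_mul_le_iff₀ hNR, abs_le]
  constructor <;> linarith

/-! ### Counting traces -/

open Classical in
/-- The traces on `P` of the sets `{c | R c b}`. -/
noncomputable def traces {X Y : Type*} (R : X → Y → Prop) (P : Finset X) : Finset (Finset X) :=
  P.powerset.filter fun T => ∃ b, T = P.filter fun c => R c b

open Classical in
/-- Sauer-Shelah: if `R` cuts out all subsets only of sets with fewer than `k` elements, then the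
number of traces on a finite set is polynomially bounded. -/
theorem card_traces_le {X Y : Type*} (R : X → Y → Prop) (k : ℕ)
    (hR : ∀ S : Finset X, (∀ T ⊆ S, ∃ b, S.filter (fun c => R c b) = T) → S.card < k)
    (P : Finset X) : (traces R P).card ≤ (P.card + 1) ^ k := by
  have hsub : (traces R P).shatterer ⊆ (Finset.range k).biUnion fun i => P.powersetCard i := by
    intro S hS
    rw [Finset.mem_shatterer] at hS
    have hSP : S ⊆ P := by
      obtain ⟨u, hu, hSu⟩ := hS Finset.Subset.rfl
      exact (Finset.inter_eq_left.1 hSu).trans (Finset.mem_powerset.1 (Finset.mem_filter.1 hu).1)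
    simp only [Finset.mem_biUnion, Finset.mem_range, Finset.mem_powersetCard]
    refine ⟨S.card, hR S fun T hT => ?_, hSP, rfl⟩
    obtain ⟨u, hu, rfl⟩ := hS hT
    obtain ⟨b, rfl⟩ := (Finset.mem_filter.1 hu).2
    refine ⟨b, ?_⟩
    ext c
    simp only [Finset.mem_filter, Finset.mem_inter]
    exact ⟨fun h => ⟨h.1, hSP h.1, h.2⟩, fun h => ⟨h.1, h.2.2⟩⟩
  calc (traces R P).card ≤ (traces R P).shatterer.card := Finset.card_le_card_shatterer _
    _ ≤ ∑ i ∈ Finset.range k, (P.powersetCard i).card :=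
        (Finset.card_le_card hsub).trans Finset.card_biUnion_le
    -- The factor `k.choose i ≥ 1` is inserted to reach the binomial theorem.
    _ ≤ ∑ i ∈ Finset.range k, P.card ^ i * k.choose i := by
        refine Finset.sum_le_sum fun i hi => ?_
        rw [Finset.card_powersetCard]
        exact (Nat.choose_le_pow _ _).trans
          (Nat.le_mul_of_pos_right _ (Nat.choose_pos (Finset.mem_range.1 hi).le))
    _ ≤ ∑ i ∈ Finset.range (k + 1), P.card ^ i * k.choose i :=
        Finset.sum_le_sum_of_subset (Finset.range_mono (Nat.le_succ k))
    _ = (P.card + 1) ^ k := by simp [add_pow]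

open Classical in
/-- If the traces of the points `b K j` on the points `a i t` determine `K`, then there are
enough traces. -/
theorem two_pow_le_of_injective {X Y : Type*} (R : X → Y → Prop) (k : ℕ)
    (hR : ∀ S : Finset X, (∀ T ⊆ S, ∃ b, S.filter (fun c => R c b) = T) → S.card < k)
    {n N N' : ℕ} (a : Fin n → Fin N → X) (b : Finset (Fin n) → Fin N' → Y)
    (hb : ∀ K K', (∀ i t j, R (a i t) (b K j) ↔ R (a i t) (b K' j)) → K = K') :
    2 ^ n ≤ ((n * N + 1) ^ k) ^ N' := by
  set P : Finset X := Finset.univ.image fun p : Fin n × Fin N => a p.1 p.2 with hP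
  have hPc : P.card ≤ n * N := by
    refine Finset.card_image_le.trans ?_
    simp
  have haP : ∀ i t, a i t ∈ P := fun i t => Finset.mem_image.2 ⟨(i, t), Finset.mem_univ _, rfl⟩
  let F : Finset (Fin n) → Fin N' → traces R P := fun K j =>
    ⟨P.filter fun c => R c (b K j), by
      simp only [traces, Finset.mem_filter, Finset.mem_powerset]
      exact ⟨Finset.filter_subset _ _, _, rfl⟩⟩
  have hF : Function.Injective F := by
    intro K K' h
    refine hb K K' fun i t j => ?_
    have h1 : P.filter (fun c => R c (b K j)) = P.filter fun c => R c (b K' j) :=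
      congrArg Subtype.val (congrFun h j)
    have h2 := Finset.ext_iff.1 h1 (a i t)
    simpa [haP i t] using h2
  have := Fintype.card_le_of_injective F hF
  simp only [Fintype.card_finset, Fintype.card_fin, Fintype.card_fun, Fintype.card_coe] at this
  exact this.trans (Nat.pow_le_pow_left ((card_traces_le R k hR P).trans
    (Nat.pow_le_pow_left (Nat.succ_le_succ hPc) k)) N')

/-! ### Growth estimates -/

theorem exists_mul_sq_lt_two_pow (C : ℕ) : ∃ m : ℕ, C * (m + 1) ^ 2 < 2 ^ m := by
  have h := (tendsto_pow_const_div_const_pow_of_one_lt 2 (r := (2 : ℝ)) one_lt_two).comp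
    (Filter.tendsto_add_atTop_nat 1)
  have hC : (0 : ℝ) < 1 / (2 * (C + 1)) := by positivity
  obtain ⟨m, hm⟩ := (h.eventually (gt_mem_nhds hC)).exists
  refine ⟨m, ?_⟩
  simp only [Function.comp_apply] at hm
  rw [div_lt_div_iff₀ (by positivity) (by positivity), pow_succ (2 : ℝ) m] at hm
  push_cast at hm
  have h2 : (C : ℝ) * (m + 1) ^ 2 < 2 ^ m := by nlinarith [sq_nonneg ((m : ℝ) + 1)]
  exact_mod_cast h2

/-- The growth estimate that rules out too many traces. -/
theorem exists_growth (k c : ℕ) :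
    ∃ m : ℕ, ((2 ^ m * (c * (2 ^ m + 1)) + 1) ^ k) ^ (c * (m + 1)) < 2 ^ 2 ^ m := by
  -- The base is at most `2 ^ (2 * m + c + 1)`, and `2 * m + c + 1 ≤ (c + 4) * (m + 1)`.
  obtain ⟨m, hm⟩ := exists_mul_sq_lt_two_pow ((c + 4) * k * c)
  refine ⟨m, ?_⟩
  have hpos : 1 ≤ 2 ^ m := Nat.one_le_two_pow
  have hc : c + 1 ≤ 2 ^ c := Nat.lt_two_pow_self
  have h1 : 2 ^ m * (c * (2 ^ m + 1)) + 1 ≤ 2 ^ (2 * m + c + 1) := by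
    have e : 2 ^ (2 * m + c + 1) = 2 ^ m * (2 ^ m * 2) * 2 ^ c := by ring
    rw [e]
    calc 2 ^ m * (c * (2 ^ m + 1)) + 1 ≤ 2 ^ m * (2 ^ m * 2) * (c + 1) := by
          have h2 : 2 ^ m * c ≤ 2 ^ m * (2 ^ m * c) :=
            Nat.mul_le_mul_left _ (Nat.le_mul_of_pos_left _ hpos)
          have h3 : 1 ≤ 2 ^ m * 2 ^ m := Nat.mul_pos hpos hpos
          linarith
      _ ≤ _ := Nat.mul_le_mul_left _ hc
  calc ((2 ^ m * (c * (2 ^ m + 1)) + 1) ^ k) ^ (c * (m + 1))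
      ≤ ((2 ^ (2 * m + c + 1)) ^ k) ^ (c * (m + 1)) :=
        Nat.pow_le_pow_left (Nat.pow_le_pow_left h1 k) _
    _ = 2 ^ ((2 * m + c + 1) * (k * c * (m + 1))) := by
        rw [← pow_mul, ← pow_mul]
        ring_nf
    _ ≤ 2 ^ ((c + 4) * k * c * (m + 1) ^ 2) := by
        refine Nat.pow_le_pow_right two_pos ?_
        calc (2 * m + c + 1) * (k * c * (m + 1))
            ≤ ((c + 4) * (m + 1)) * (k * c * (m + 1)) := Nat.mul_le_mul_right _ (by nlinarith)
          _ = _ := by ring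
    _ < 2 ^ 2 ^ m := Nat.pow_lt_pow_right one_lt_two hm

theorem log_two_mul_two_pow_le (m : ℕ) : Real.log (2 * 2 ^ m) ≤ m + 1 := by
  rw [← pow_succ', Real.log_pow]
  push_cast
  exact mul_le_of_le_one_right (by positivity) (by linarith [Real.log_two_lt_d9])

/-! ### Shattered measures yield too many traces -/

open Classical in
/-- A relation of finite VC dimension has a dependent extension to convex combinations. -/
theorem dependent_Psi {X Y : Type*} (f : X → Y → ({0, 1} : Set ℝ)) (k : ℕ)
    (hR : ∀ S : Finset X, (∀ T ⊆ S, ∃ b, S.filter (fun c => (f c b : ℝ) = 1) = T) → S.card < k) :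
    Dependent (Psi f) := by
  rintro ⟨r, -, ε, hε, hind⟩
  -- Two approximations cost `2 * δ ≤ 2 * ε / 5 < ε / 2`; the cap `1` is required by
  -- `exists_average_approx`.
  set δ : ℝ := min (ε / 5) 1 with hδ
  have hδ0 : 0 < δ := lt_min (by linarith) one_pos
  have hδ1 : δ ≤ 1 := min_le_right _ _
  have hδε : δ ≤ ε / 5 := min_le_left _ _
  obtain ⟨c, hc⟩ := exists_nat_ge (4 / δ ^ 2)
  have hcδ : 4 ≤ c * δ ^ 2 := (div_le_iff₀ (by positivity)).1 hc
  have hc0 : 0 < c := by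
    rcases Nat.eq_zero_or_pos c with rfl | h
    · norm_num at hcδ
    · exact h
  have hf01 : ∀ a b, (f a b : ℝ) ∈ Set.Icc (0 : ℝ) 1 := fun a b => by
    rcases (f a b).2 with h | h
    · simp [h]
    · simp [Set.mem_singleton_iff.1 h]
  obtain ⟨m, hm⟩ := exists_growth k c
  obtain ⟨A, hA, hsh⟩ := hind (2 ^ m)
  obtain ⟨A', hA'A, hA'⟩ := Set.exists_subset_encard_eq hA.le
  have hfin : A'.Finite := Set.finite_of_encard_eq_coe hA'
  let _ : Fintype A' := hfin.fintype
  have hcard : Fintype.card A' = 2 ^ m := by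
    rw [Set.encard_eq_coe_toFinset_card, Set.toFinset_card] at hA'
    exact_mod_cast hA'
  let e : Fin (2 ^ m) ≃ A' := (Fintype.equivFinOfCardEq hcard).symm
  have hex : ∀ K : Finset (Fin (2 ^ m)), ∃ ν : Conv Y,
      (∀ i ∈ K, (Psi f (e i).1 ν : ℝ) ≤ r) ∧ ∀ i ∉ K, r + ε ≤ (Psi f (e i).1 ν : ℝ) := by
    intro K
    obtain ⟨ν, h1, h2⟩ := hsh ((fun i => (e i).1) '' (K : Set (Fin (2 ^ m))))
      (by rintro _ ⟨i, -, rfl⟩; exact hA'A (e i).2)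
    refine ⟨ν, fun i hi => ?_, fun i hi => ?_⟩
    · exact (h1.symm.subset ⟨i, hi, rfl⟩).1
    · refine (h2.symm.subset ⟨hA'A (e i).2, ?_⟩).1
      rintro ⟨i', hi', he⟩
      exact hi (e.injective (Subtype.ext he) ▸ hi')
  choose ν hν1 hν2 using hex
  choose kx x rx hrx0 hrx1 hμ using fun i => (e i).1.2
  choose ky y ry hry0 hry1 hν using fun K => (ν K).2
  have hrx1' : ∀ i, ∑ j, (rx i j : ℝ) = 1 := fun i => by exact_mod_cast hrx1 i
  have hry1' : ∀ K, ∑ j, (ry K j : ℝ) = 1 := fun K => by exact_mod_cast hry1 K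
  have hPsi : ∀ i K, (Psi f (e i).1 (ν K) : ℝ) =
      ∑ p, (rx i p : ℝ) * ∑ q, (ry K q : ℝ) * f (x i p) (y K q) := fun i K => by
    rw [Psi_eq_sum f _ _ (x i) (rx i) (y K) (ry K) (hμ i) (hν K)]
    refine Finset.sum_congr rfl fun p _ => ?_
    rw [Finset.mul_sum]
    exact Finset.sum_congr rfl fun q _ => by ring
  -- As `c * δ ^ 2 ≥ 4`, these lengths suffice for `2 ^ 2 ^ m` test functions (one per `K`) and `2 ^
  -- m` test functions (one per `i`), respectively.
  set N := c * (2 ^ m + 1) with hN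
  set N' := c * (m + 1) with hN'
  have hN0 : 0 < N := by positivity
  have hN'0 : 0 < N' := by positivity
  have step1 : ∀ i, ∃ a : Fin N → X, ∀ K,
      |∑ p, (rx i p : ℝ) * ∑ q, (ry K q : ℝ) * f (x i p) (y K q) -
        (N : ℝ)⁻¹ * ∑ t, ∑ q, (ry K q : ℝ) * f (a t) (y K q)| ≤ δ := by
    intro i
    refine exists_average_approx (x i) (fun p => (rx i p : ℝ)) (fun p => (rx i p).2) (hrx1' i)
      (fun K b => ∑ q, (ry K q : ℝ) * f b (y K q)) (fun K b => ⟨?_, ?_⟩) hδ0 hδ1 hN0 ?_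
    · exact Finset.sum_nonneg fun q _ => mul_nonneg (ry K q).2 (hf01 _ _).1
    · exact (Finset.sum_le_sum fun q _ =>
        mul_le_of_le_one_right (ry K q).2 (hf01 _ _).2).trans_eq (hry1' K)
    · have := log_two_mul_two_pow_le (2 ^ m)
      rw [Fintype.card_finset, Fintype.card_fin, hN]
      push_cast at this ⊢
      nlinarith [pow_pos (two_pos : (0 : ℝ) < 2) m]
  choose a ha using step1
  have step2 : ∀ K, ∃ b : Fin N' → Y, ∀ i,
      |∑ q, (ry K q : ℝ) * ((N : ℝ)⁻¹ * ∑ t, (f (a i t) (y K q) : ℝ)) -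
        (N' : ℝ)⁻¹ * ∑ j, (N : ℝ)⁻¹ * ∑ t, (f (a i t) (b j) : ℝ)| ≤ δ := by
    intro K
    refine exists_average_approx (y K) (fun q => (ry K q : ℝ)) (fun q => (ry K q).2) (hry1' K)
      (fun i b => (N : ℝ)⁻¹ * ∑ t, (f (a i t) b : ℝ)) (fun i b => ⟨?_, ?_⟩) hδ0 hδ1 hN'0 ?_
    · exact mul_nonneg (by positivity) (Finset.sum_nonneg fun t _ => (hf01 _ _).1)
    · rw [inv_mul_le_iff₀ (by exact_mod_cast hN0), mul_one]
      refine (Finset.sum_le_sum fun t _ => (hf01 _ _).2).trans ?_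
      simp
    · have := log_two_mul_two_pow_le m
      rw [Fintype.card_fin, hN']
      push_cast at this ⊢
      nlinarith
  choose b hb using step2
  set V : Finset (Fin (2 ^ m)) → Fin (2 ^ m) → ℝ := fun K i =>
    (N' : ℝ)⁻¹ * ∑ j, (N : ℝ)⁻¹ * ∑ t, (f (a i t) (b K j) : ℝ) with hV
  have happrox : ∀ K i, |(Psi f (e i).1 (ν K) : ℝ) - V K i| ≤ δ + δ := by
    intro K i
    have h1 := ha i K
    have h2 := hb K i
    have h3 : ∑ q, (ry K q : ℝ) * ((N : ℝ)⁻¹ * ∑ t, (f (a i t) (y K q) : ℝ)) =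
        (N : ℝ)⁻¹ * ∑ t, ∑ q, (ry K q : ℝ) * f (a i t) (y K q) := by
      rw [Finset.sum_comm, Finset.mul_sum]
      refine Finset.sum_congr rfl fun q _ => ?_
      rw [← Finset.mul_sum]
      ring
    rw [← hPsi] at h1
    rw [h3] at h2
    exact (abs_sub_le _ _ _).trans (add_le_add h1 h2)
  -- The midpoint of the gap still separates the approximate values.
  have hmem : ∀ K i, i ∈ K ↔ V K i < r + ε / 2 := by
    intro K i
    have h := abs_le.1 (happrox K i)
    constructor
    · intro hi
      linarith [hν1 K i hi, h.1]
    · intro hlt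
      by_contra hi
      linarith [hν2 K i hi, h.2]
  -- `V K` depends only on the truth values at the sample points, and it determines `K`.
  refine absurd (two_pow_le_of_injective (fun c b => (f c b : ℝ) = 1) k hR a b ?_) (not_le.2 hm)
  intro K K' h
  have hff : ∀ i t j, (f (a i t) (b K j) : ℝ) = f (a i t) (b K' j) := by
    intro i t j
    have hor : ∀ z : ({0, 1} : Set ℝ), (z : ℝ) = 0 ∨ (z : ℝ) = 1 := fun z => z.2
    rcases hor (f (a i t) (b K j)) with h0 | h1
    · rcases hor (f (a i t) (b K' j)) with h0' | h1'
      · rw [h0, h0']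
      · rw [(h i t j).2 h1', h1']
    · rw [h1, (h i t j).1 h1]
  ext i
  rw [hmem, hmem]
  simp only [hV, hff]

end ContVC

theorem mainTheorem3 {L : FirstOrder.Language} {U : Type*} [L.Structure U] {m n : ℕ}
    (φ : L.Formula (Fin m ⊕ Fin n)) (hφ : ContVC.IsNIP U φ) :
    ContVC.Dependent (ContVC.Psi (ContVC.formulaIndicator U φ)) := by
  classical
  simp only [ContVC.IsNIP, ContVC.IsIP, not_forall] at hφ
  obtain ⟨k, hk⟩ := hφ
  refine ContVC.dependent_Psi _ k fun S hS => ?_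
  by_contra! hSk
  refine hk ⟨S, by simpa using hSk, fun K hK => ?_⟩
  -- The filter is `K` as a `Finset`, because `K ⊆ S`.
  obtain ⟨b, hb⟩ := hS (S.filter (· ∈ K)) (Finset.filter_subset _ _)
  refine ⟨b, ?_⟩
  ext c
  have h := Finset.ext_iff.1 hb c
  simp only [ContVC.formulaIndicator, Finset.mem_filter, ite_eq_left_iff, zero_ne_one, imp_false,
    not_not] at h
  exact h.trans ⟨fun h => h.2, fun h => ⟨hK h, h⟩⟩
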